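/- Let $\mathcal K$ be a complex Hilbert space (of any dimension) and let $\mathcal B_2(\mathcal K)$ be the Hilbert space of Hilbert–Schmidt operators on $\mathcal K$ with the inner product $\langle A,B\rangle_2=\operatorname{tr}(A^\dagger B)$. Let $\rho,\sigma$ be states on $\mathcal K$, i.e. positive trace class operators of trace one (not necessarily faithful), with spectral decompositions $$\rho=\sum_{i\in\mathcal I}r_i|u_i\rangle\langle u_i|,\qquad \sigma=\sum_{j\in\mathcal I}s_j|v_j\rangle\langle v_j|,$$ where $r_i,s_j\ge 0$, $\sum_i r_i=\sum_j s_j=1$, and $\{u_i\}_{i\in\mathcal I}$, $\{v_j\}_{j\in\mathcal I}$ are orthonormal bases of $\mathcal K$. Let $\Pi_\sigma$ be the orthogonal projection onto the support $(\ker\sigma)^\perp$ of $\sigma$, and let $S$ be the densely defined, closable antilinear operator on $\mathcal B_2(\mathcal K)$ with domain $$D(S)=\{X\sqrt\sigma: X\in\mathcal B(\mathcal K)\}+\{Y(I-\Pi_\sigma): Y\in\mathcal B_2(\mathcal K)\},\qquad S\bigl(X\sqrt\sigma+Y(I-\Pi_\sigma)\bigr)=\Pi_\sigma X^\dagger\sqrt\rho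 .$$ Let $\overline S$ be its closure, let $S^\dagger$ be its adjoint (so $S^\dagger a=c$ means $\langle a,Sb\rangle_2=\overline{\langle c,b\rangle_2}$ for all $b\in D(S)$), and let $\Delta_{\rho,\sigma}=S^\dagger\overline S$ be the relative modular operator. Put $X_{ij}=|u_i\rangle\langle v_j|$. Then: 1. $\{X_{ij}\}_{i,j\in\mathcal I}$ is an orthonormal basis of $\mathcal B_2(\mathcal K)$. 2. $\Delta_{\rho,\sigma}=\sum_{\{i,j:\,r_i\ne0,\,s_j\ne0\}}r_is_j^{-1}|X_{ij}\rangle\langle X_{ij}|$; that is, the domain of $\Delta_{\rho,\sigma}$ is the set of all $A\in\mathcal B_2(\mathcal K)$ with $\sum_{\{i,j:\,r_i\ne0,\,s_j\ne0\}}(r_i/s_j)^2|\langle X_{ij},A\rangle_2|^2<\infty$, and for such $A$ $$\Delta_{\rho,\sigma}A=\sum_{\{i,j:\,r_i\ne0,\,s_j\ne0\}}\frac{r_i}{s_j}\,\langle X_{ij},A\rangle_2\,X_{ij}\quad\text{in }\mathcal B_2(\mathcal K).$$ In particular $\Delta_{\rho,\sigma}X_{ij}=r_is_j^{-1}X_{ij}$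 whenever $r_i\neq0$ and $s_j\ne0$. 3. $\ker\Delta_{\rho,\sigma}=\overline{\operatorname{span}}\{X_{ij}: r_i=0\text{ or }s_j=0\}$. -/

import Mathlib

noncomputable section

open scoped ComplexConjugate ENNReal

namespace RelMod

universe u

variable (K : Type u) [NormedAddCommGroup K] [InnerProductSpace ℂ K] [CompleteSpace K]

/-! ### Hilbert–Schmidt operators -/

/-- The index set of a fixed orthonormal (Hilbert) basis of `K`. -/
def refIndex : Set K := (exists_hilbertBasis ℂ K).choose

/-- A fixed orthonormal (Hilbert) basis of `K`, used to write down traces. By `isHS_iff`,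
`HS.hasSum_inner` and `DensityOperator.hasSum_trace` below nothing depends on this choice. -/
def refBasis : HilbertBasis (refIndex K) ℂ K := (exists_hilbertBasis ℂ K).choose_spec.choose

variable {K}

/-- `A` is Hilbert–Schmidt: `∑ i, ‖A eᵢ‖² < ∞`. -/
def IsHS (A : K →L[ℂ] K) : Prop := Summable fun i => ‖A (refBasis K i)‖ ^ 2

theorem hasSum_norm_inner_sq {ι : Type*} (b : HilbertBasis ι ℂ K) (x : K) :
    HasSum (fun i => ‖inner ℂ (b i) x‖ ^ 2) (‖x‖ ^ 2) := by
  have h := b.hasSum_inner_mul_inner x x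
  have h2 : (fun i => inner ℂ x (b i) * inner ℂ (b i) x)
      = fun i => ((‖inner ℂ (b i) x‖ ^ 2 : ℝ) : ℂ) := by
    funext i
    rw [← inner_conj_symm x (b i), Complex.conj_mul']
    push_cast; rfl
  have h3 : inner ℂ x x = ((‖x‖ ^ 2 : ℝ) : ℂ) := by
    rw [inner_self_eq_norm_sq_to_K]; push_cast; rfl
  rw [h2, h3] at h
  exact Complex.hasSum_ofReal.1 h

theorem tsum_enorm_inner_sq {ι : Type*} (b : HilbertBasis ι ℂ K) (x : K) :
    ∑' i, ‖inner ℂ (b i) x‖ₑ ^ 2 = ‖x‖ₑ ^ 2 := by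
  have h := hasSum_norm_inner_sq b x
  have h3 := ENNReal.ofReal_tsum_of_nonneg (fun i => by positivity) h.summable
  rw [h.tsum_eq] at h3
  simpa [ENNReal.ofReal_pow, ofReal_norm] using h3.symm

theorem tsum_enorm_sq_adjoint {ι κ : Type*} (b : HilbertBasis ι ℂ K) (c : HilbertBasis κ ℂ K)
    (A : K →L[ℂ] K) :
    ∑' i, ‖A (b i)‖ₑ ^ 2 = ∑' k, ‖A.adjoint (c k)‖ₑ ^ 2 := by
  simp_rw [← tsum_enorm_inner_sq c (A _), ← tsum_enorm_inner_sq b (A.adjoint _)]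
  rw [ENNReal.tsum_comm]
  refine tsum_congr fun k => tsum_congr fun i => ?_
  rw [ContinuousLinearMap.adjoint_inner_right, ← ofReal_norm, ← ofReal_norm, norm_inner_symm]

theorem summable_sq_iff {ι : Type*} (f : ι → K) :
    (Summable fun i => ‖f i‖ ^ 2) ↔ ∑' i, ‖f i‖ₑ ^ 2 ≠ ∞ := by
  have h : (fun i => ‖f i‖ₑ ^ 2) = fun i => ((‖f i‖₊ ^ 2 : NNReal) : ℝ≥0∞) := by
    funext i; simp [enorm_eq_nnnorm]
  rw [h, ENNReal.tsum_coe_ne_top_iff_summable, ← NNReal.summable_coe]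
  simp

/-- Being Hilbert–Schmidt does not depend on the orthonormal basis. -/
theorem isHS_iff {ι : Type*} (b : HilbertBasis ι ℂ K) (A : K →L[ℂ] K) :
    IsHS A ↔ Summable fun i => ‖A (b i)‖ ^ 2 := by
  rw [IsHS, summable_sq_iff, summable_sq_iff, tsum_enorm_sq_adjoint (refBasis K) (refBasis K),
    tsum_enorm_sq_adjoint b (refBasis K)]

theorem IsHS.adjoint {A : K →L[ℂ] K} (hA : IsHS A) : IsHS A.adjoint := by
  rw [IsHS, summable_sq_iff] at *
  rwa [← tsum_enorm_sq_adjoint (refBasis K) (refBasis K)]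

theorem IsHS.mul_left {A : K →L[ℂ] K} (hA : IsHS A) (X : K →L[ℂ] K) : IsHS (X * A) := by
  refine Summable.of_nonneg_of_le (fun i => by positivity) (fun i => ?_)
    (Summable.mul_left (‖X‖ ^ 2) hA)
  rw [← mul_pow]
  gcongr
  exact X.le_opNorm _

theorem IsHS.mul_right {A : K →L[ℂ] K} (hA : IsHS A) (X : K →L[ℂ] K) : IsHS (A * X) := by
  have h := (hA.adjoint.mul_left X.adjoint).adjoint
  rwa [ContinuousLinearMap.mul_def, ContinuousLinearMap.adjoint_comp,
    ContinuousLinearMap.adjoint_adjoint, ContinuousLinearMap.adjoint_adjoint] at h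

theorem isHS_memℓp (A : K →L[ℂ] K) :
    IsHS A ↔ Memℓp (fun i => A (refBasis K i)) 2 := by
  rw [memℓp_gen_iff (by norm_num)]
  simp [IsHS]

variable (K)

/-- The linear space of Hilbert–Schmidt operators. -/
def hsSubmodule : Submodule ℂ (K →L[ℂ] K) where
  carrier := {A | IsHS A}
  zero_mem' := by simp [IsHS]
  add_mem' {A B} hA hB := by
    simp only [Set.mem_ofPred_eq, isHS_memℓp] at *
    exact hA.add hB
  smul_mem' c A hA := by
    simp only [Set.mem_ofPred_eq, isHS_memℓp] at *
    exact hA.const_smul c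

/-- The space of Hilbert–Schmidt operators on `K`. This is a type synonym, so that it carries the
Hilbert–Schmidt norm defined below and not the operator norm. -/
def HS : Type u := ↥(hsSubmodule K)

instance : AddCommGroup (HS K) := inferInstanceAs (AddCommGroup ↥(hsSubmodule K))
instance : Module ℂ (HS K) := inferInstanceAs (Module ℂ ↥(hsSubmodule K))

variable {K}

namespace HS

/-- The underlying bounded operator, as a linear map. -/
def op : HS K →ₗ[ℂ] (K →L[ℂ] K) := (hsSubmodule K).subtype

/-- A Hilbert–Schmidt operator as an element of `HS K`. -/
def mk (A : K →L[ℂ] K) (hA : IsHS A) : HS K := ⟨A, hA⟩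

@[simp] theorem op_mk (A : K →L[ℂ] K) (hA : IsHS A) : (mk A hA).op = A := rfl

theorem isHS (A : HS K) : IsHS A.op := A.2

@[ext] theorem ext {A B : HS K} (h : A.op = B.op) : A = B := Subtype.ext h

/-- The columns `A eᵢ`, as an element of `ℓ²`. -/
def toLp : HS K →ₗ[ℂ] lp (fun _ : refIndex K => K) 2 where
  toFun A := ⟨fun i => A.op (refBasis K i), (isHS_memℓp _).1 A.isHS⟩
  map_add' A B := by ext i; simp; rfl
  map_smul' c A := by ext i; simp

@[simp] theorem toLp_apply (A : HS K) (i : refIndex K) : toLp A i = A.op (refBasis K i) := rfl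

theorem toLp_injective : Function.Injective (toLp : HS K →ₗ[ℂ] _) := by
  intro A B h
  ext1
  refine ContinuousLinearMap.ext_on
    (Submodule.dense_iff_topologicalClosure_eq_top.2 (refBasis K).dense_span) ?_
  rintro _ ⟨i, rfl⟩
  rw [← toLp_apply, ← toLp_apply, h]

/-- The inner product `⟨A, B⟩₂ = tr (A† B) = ∑ i, ⟨A eᵢ, B eᵢ⟩`. -/
instance : Inner ℂ (HS K) := ⟨fun A B => ∑' i, inner ℂ (A.op (refBasis K i)) (B.op (refBasis K i))⟩

theorem inner_def (A B : HS K) :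
    inner ℂ A B = ∑' i, inner ℂ (A.op (refBasis K i)) (B.op (refBasis K i)) := rfl

theorem inner_eq_toLp (A B : HS K) : inner ℂ A B = inner ℂ (toLp A) (toLp B) := by
  rw [lp.inner_eq_tsum, inner_def]; rfl

@[reducible] def core : InnerProductSpace.Core ℂ (HS K) where
  inner A B := inner ℂ A B
  conj_inner_symm A B := by simp only [inner_eq_toLp, inner_conj_symm]
  re_inner_nonneg A := by rw [inner_eq_toLp]; exact inner_self_nonneg
  add_left A B C := by simp only [inner_eq_toLp, map_add, inner_add_left]
  smul_left A B c := by simp only [inner_eq_toLp, map_smul, inner_smul_left]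
  definite A h := by
    rw [inner_eq_toLp, inner_self_eq_zero] at h
    exact toLp_injective (h.trans (map_zero _).symm)

instance : NormedAddCommGroup (HS K) :=
  InnerProductSpace.Core.toNormedAddCommGroup (cd := core (K := K))
instance : InnerProductSpace ℂ (HS K) := InnerProductSpace.ofCore (core (K := K)).toCore

theorem norm_toLp (A : HS K) : ‖toLp A‖ = ‖A‖ := by
  rw [@norm_eq_sqrt_re_inner ℂ, @norm_eq_sqrt_re_inner ℂ, ← inner_eq_toLp]

theorem ofReal_tsum_norm_sq {ι : Type*} (b : HilbertBasis ι ℂ K) (A : HS K) :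
    ENNReal.ofReal (∑' i, ‖A.op (b i)‖ ^ 2) = ∑' i, ‖A.op (b i)‖ₑ ^ 2 := by
  rw [ENNReal.ofReal_tsum_of_nonneg (fun i => by positivity) ((isHS_iff b _).1 A.isHS)]
  simp [ENNReal.ofReal_pow, ofReal_norm]

theorem hasSum_norm_sq {ι : Type*} (b : HilbertBasis ι ℂ K) (A : HS K) :
    HasSum (fun i => ‖A.op (b i)‖ ^ 2) (‖A‖ ^ 2) := by
  have h1 : ‖A‖ ^ 2 = ∑' i, ‖A.op (refBasis K i)‖ ^ 2 := by
    rw [← norm_toLp]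
    have := lp.norm_rpow_eq_tsum (p := 2) (by norm_num) (toLp A)
    simpa using this
  have h2 : ∑' i, ‖A.op (b i)‖ ^ 2 = ‖A‖ ^ 2 := by
    have h3 := ofReal_tsum_norm_sq b A
    have h4 := ofReal_tsum_norm_sq (refBasis K) A
    rw [tsum_enorm_sq_adjoint b (refBasis K)] at h3
    rw [tsum_enorm_sq_adjoint (refBasis K) (refBasis K), ← h3] at h4
    rw [h1]
    exact ((ENNReal.ofReal_eq_ofReal_iff (tsum_nonneg fun i => by positivity)
      (tsum_nonneg fun i => by positivity)).1 h4).symm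
  rw [← h2]
  exact ((isHS_iff b _).1 A.isHS).hasSum

/-- The Hilbert–Schmidt inner product does not depend on the orthonormal basis. -/
theorem hasSum_inner {ι : Type*} (b : HilbertBasis ι ℂ K) (A B : HS K) :
    HasSum (fun i => inner ℂ (A.op (b i)) (B.op (b i))) (inner ℂ A B) := by
  have h (C : HS K) := Complex.hasSum_ofReal.2 (hasSum_norm_sq b C)
  have h2 := (((h (A + B)).sub (h (A - B))).add
    (((h (A - Complex.I • B)).sub (h (A + Complex.I • B))).mul_right Complex.I)).div_const 4
  have e1 : (inner ℂ A B : ℂ) = ((‖A + B‖ ^ 2 : ℝ) - (‖A - B‖ ^ 2 : ℝ)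
      + ((‖A - Complex.I • B‖ ^ 2 : ℝ) - (‖A + Complex.I • B‖ ^ 2 : ℝ)) * Complex.I) / 4 := by
    rw [inner_eq_sum_norm_sq_div_four A B]; push_cast; rfl
  rw [e1]
  refine h2.congr_fun fun i => ?_
  rw [inner_eq_sum_norm_sq_div_four (A.op (b i)) (B.op (b i))]
  simp

/-- The rank one operator `|x⟩⟨y|`, that is `z ↦ ⟨y, z⟩ x`. -/
def ketBra (x y : K) : HS K := mk (InnerProductSpace.rankOne ℂ x y) (by
  have h := (hasSum_norm_inner_sq (refBasis K) y).summable.mul_right (‖x‖ ^ 2)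
  refine h.congr fun i => ?_
  rw [InnerProductSpace.rankOne_apply, norm_smul, mul_pow, norm_inner_symm])

theorem ketBra_apply (x y z : K) : (ketBra x y).op z = inner ℂ y z • x := rfl

theorem inner_ketBra (x y : K) (A : HS K) : inner ℂ (ketBra x y) A = inner ℂ x (A.op y) := by
  refine (hasSum_inner (refBasis K) (ketBra x y) A).unique ?_
  have h := (((refBasis K).hasSum_repr y).mapL A.op).mapL (innerSL ℂ x)
  refine h.congr_fun fun i => ?_
  simp [ketBra_apply, HilbertBasis.repr_apply_apply, mul_comm]

theorem norm_op_apply_le (A : HS K) (x : K) : ‖A.op x‖ ≤ ‖A‖ * ‖x‖ := by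
  rcases eq_or_ne (A.op x) 0 with h0 | h0
  · rw [h0, norm_zero]; positivity
  have h1 : ‖ketBra (A.op x) x‖ = ‖A.op x‖ * ‖x‖ := by
    have h2 : ‖ketBra (A.op x) x‖ ^ 2 = (‖A.op x‖ * ‖x‖) ^ 2 := by
      have h3 : ((‖ketBra (A.op x) x‖ ^ 2 : ℝ) : ℂ) = ((‖A.op x‖ * ‖x‖) ^ 2 : ℝ) := by
        have := inner_ketBra (A.op x) x (ketBra (A.op x) x)
        rw [ketBra_apply, inner_smul_right, inner_self_eq_norm_sq_to_K,
          inner_self_eq_norm_sq_to_K, inner_self_eq_norm_sq_to_K] at this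
        push_cast
        exact this.trans (mul_comm _ _) |>.trans (mul_pow _ _ _).symm
      exact_mod_cast h3
    exact (sq_eq_sq₀ (by positivity) (by positivity)).1 h2
  have h2 := norm_inner_le_norm (𝕜 := ℂ) (ketBra (A.op x) x) A
  rw [inner_ketBra, h1, inner_self_eq_norm_sq_to_K] at h2
  have h3 : ‖A.op x‖ * ‖A.op x‖ ≤ ‖A.op x‖ * (‖A‖ * ‖x‖) := by
    simp only [norm_pow, RCLike.norm_ofReal, abs_norm] at h2
    nlinarith
  exact le_of_mul_le_mul_left h3 (norm_pos_iff.2 h0)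

instance : CompleteSpace (HS K) := by
  refine Metric.complete_of_cauchySeq_tendsto fun w hw => ?_
  have hop : ∀ A : HS K, ‖A.op‖ ≤ 1 * ‖A‖ := fun A => by
    rw [one_mul]
    exact A.op.opNorm_le_bound (norm_nonneg _) (norm_op_apply_le A)
  let opL : HS K →L[ℂ] (K →L[ℂ] K) := LinearMap.mkContinuous op 1 hop
  let lpL : HS K →ₗᵢ[ℂ] lp (fun _ : refIndex K => K) 2 := ⟨toLp, norm_toLp⟩
  obtain ⟨T, hT⟩ := cauchySeq_tendsto_of_complete (opL.uniformContinuous.comp_cauchySeq hw)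
  obtain ⟨f, hf⟩ := cauchySeq_tendsto_of_complete 
    (lpL.isometry.uniformContinuous.comp_cauchySeq hw)
  have hfT : ∀ i, f i = T (refBasis K i) := by
    intro i
    have h1 : Filter.Tendsto (fun n => (lpL (w n)) i) Filter.atTop (nhds (f i)) :=
      ((lp.evalCLM ℂ (fun _ : refIndex K => K) 2 i).continuous.tendsto f).comp hf
    have h2 : Filter.Tendsto (fun n => opL (w n) (refBasis K i)) Filter.atTop
        (nhds (T (refBasis K i))) :=
      ((ContinuousLinearMap.apply ℂ K (refBasis K i)).continuous.tendsto T).comp hT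
    exact tendsto_nhds_unique h1 h2
  have hTHS : IsHS T := by
    rw [isHS_memℓp]
    have h : (fun i => T (refBasis K i)) = f := funext fun i => (hfT i).symm
    rw [h]
    exact f.2
  refine ⟨mk T hTHS, ?_⟩
  rw [lpL.isometry.isEmbedding.tendsto_nhds_iff]
  convert hf using 2
  ext i
  exact (hfT i).symm

/-- The product `X A` of a bounded and a Hilbert–Schmidt operator. -/
def lmul (X : K →L[ℂ] K) (A : HS K) : HS K := mk (X * A.op) (A.isHS.mul_left X)

/-- The product `A X` of a Hilbert–Schmidt and a bounded operator. -/
def rmul (A : HS K) (X : K →L[ℂ] K) : HS K := mk (A.op * X) (A.isHS.mul_right X)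

@[simp] theorem op_lmul (X : K →L[ℂ] K) (A : HS K) : (lmul X A).op = X * A.op := rfl
@[simp] theorem op_rmul (A : HS K) (X : K →L[ℂ] K) : (rmul A X).op = A.op * X := rfl

end HS

/-! ### States -/

variable (K)

/-- A state: a positive (trace class) operator with `tr ρ = ∑ i, ⟨eᵢ, ρ eᵢ⟩ = 1`. -/
structure DensityOperator where
  /-- The operator itself. -/
  op : K →L[ℂ] K
  isPositive : op.IsPositive
  trace_eq_one : HasSum (fun i => inner ℂ (refBasis K i) (op (refBasis K i))) 1

variable {K}

namespace DensityOperator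

theorem sqrt_isPositive (ρ : DensityOperator K) : (CFC.sqrt ρ.op).IsPositive :=
  (ContinuousLinearMap.nonneg_iff_isPositive _).1 (CFC.sqrt_nonneg _)

theorem sqrt_mul_sqrt (ρ : DensityOperator K) : CFC.sqrt ρ.op * CFC.sqrt ρ.op = ρ.op :=
  CFC.sqrt_mul_sqrt_self _ ((ContinuousLinearMap.nonneg_iff_isPositive _).2 ρ.isPositive)

theorem inner_op_self (ρ : DensityOperator K) (x : K) :
    inner ℂ x (ρ.op x) = ((‖CFC.sqrt ρ.op x‖ ^ 2 : ℝ) : ℂ) := by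
  rw [← ρ.sqrt_mul_sqrt, mul_apply_eq_comp,
    ← ContinuousLinearMap.adjoint_inner_left, ρ.sqrt_isPositive.isSelfAdjoint.adjoint_eq,
    inner_self_eq_norm_sq_to_K, ρ.sqrt_mul_sqrt]
  push_cast; rfl

theorem sqrt_isHS (ρ : DensityOperator K) : IsHS (CFC.sqrt ρ.op) := by
  have h := ρ.trace_eq_one.summable
  simp only [inner_op_self] at h
  exact Complex.summable_ofReal.1 h

/-- `√ρ`, the positive square root, which is a Hilbert–Schmidt operator. -/
def sqrt (ρ : DensityOperator K) : HS K := HS.mk (CFC.sqrt ρ.op) ρ.sqrt_isHS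

@[simp] theorem op_sqrt (ρ : DensityOperator K) : ρ.sqrt.op = CFC.sqrt ρ.op := rfl

/-- The trace can be computed in any orthonormal basis. -/
theorem hasSum_trace {ι : Type*} (b : HilbertBasis ι ℂ K) (ρ : DensityOperator K) :
    HasSum (fun i => inner ℂ (b i) (ρ.op (b i))) 1 := by
  have h1 := ρ.trace_eq_one
  simp only [inner_op_self] at h1 ⊢
  have h2 := Complex.hasSum_ofReal.2 (HS.hasSum_norm_sq (refBasis K) ρ.sqrt)
  rw [h1.unique h2]
  exact Complex.hasSum_ofReal.2 (HS.hasSum_norm_sq b ρ.sqrt)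

/-- `Π_σ`, the orthogonal projection onto the support `(ker σ)ᗮ` of `σ`. -/
def supportProj (σ : DensityOperator K) : K →L[ℂ] K := (σ.op.ker)ᗮ.starProjection

theorem sqrt_apply_eq_zero (σ : DensityOperator K) {x : K} :
    CFC.sqrt σ.op x = 0 ↔ σ.op x = 0 := by
  constructor
  · intro h
    rw [← σ.sqrt_mul_sqrt, mul_apply_eq_comp, h, map_zero]
  · intro h
    have h1 := σ.inner_op_self x
    rw [h, inner_zero_right] at h1
    have h2 : ‖CFC.sqrt σ.op x‖ ^ 2 = 0 := by exact_mod_cast h1.symm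
    simpa using h2

theorem inner_sqrt (σ : DensityOperator K) (x y : K) :
    inner ℂ (CFC.sqrt σ.op x) y = inner ℂ x (CFC.sqrt σ.op y) := by
  rw [← ContinuousLinearMap.adjoint_inner_right, σ.sqrt_isPositive.isSelfAdjoint.adjoint_eq]

theorem inner_supportProj (σ : DensityOperator K) (x y : K) :
    inner ℂ (σ.supportProj x) y = inner ℂ x (σ.supportProj y) :=
  Submodule.inner_starProjection_left_eq_right _ _ _

theorem supportProj_eq_zero (σ : DensityOperator K) {x : K} :
    σ.supportProj x = 0 ↔ σ.op x = 0 := by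
  rw [supportProj, Submodule.starProjection_apply_eq_zero_iff,
    Submodule.orthogonal_orthogonal_eq_closure,
    (σ.op.isClosed_ker).submodule_topologicalClosure_eq]
  rfl

theorem supportProj_idem (σ : DensityOperator K) (x : K) :
    σ.supportProj (σ.supportProj x) = σ.supportProj x :=
  Submodule.starProjection_eq_self_iff.2 (Submodule.starProjection_apply_mem _ _)

theorem sqrt_supportProj (σ : DensityOperator K) (x : K) :
    CFC.sqrt σ.op (σ.supportProj x) = CFC.sqrt σ.op x := by
  have h : CFC.sqrt σ.op (σ.supportProj x - x) = 0 := by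
    rw [sqrt_apply_eq_zero, ← supportProj_eq_zero, map_sub, supportProj_idem, sub_self]
  rwa [map_sub, sub_eq_zero] at h

theorem supportProj_sqrt (σ : DensityOperator K) (x : K) :
    σ.supportProj (CFC.sqrt σ.op x) = CFC.sqrt σ.op x := by
  refine ext_inner_right ℂ fun w => ?_
  rw [inner_supportProj, inner_sqrt, sqrt_supportProj, inner_sqrt]

end DensityOperator

/-! ### The relative modular operator

The operators `S`, its closure and its adjoint are given by their graphs; the theorems
`tomitaGraph_single`, `closure_tomitaGraph_single`, `adjointGraph_single` and
`graph_relativeModular` show that they are (single-valued) operators. -/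

/-- The graph of the antilinear operator `S (X √σ + Y (1 - Π_σ)) = Π_σ X† √ρ`, with domain
`D(S) = {X √σ : X bounded} + {Y (1 - Π_σ) : Y Hilbert–Schmidt}`. -/
def tomitaGraph (ρ σ : DensityOperator K) : Set (HS K × HS K) :=
  {p | ∃ (X : K →L[ℂ] K) (Y : HS K),
    p.1 = HS.lmul X σ.sqrt + HS.rmul Y (1 - σ.supportProj) ∧
    p.2 = HS.lmul (σ.supportProj * X.adjoint) ρ.sqrt}

/-- The graph of the adjoint of an antilinear operator with graph `G`: the pairs `(a, a')` with
`⟨a, S b⟩ = conj ⟨a', b⟩` for all `b ∈ D(S)`. -/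
def adjointGraph (G : Set (HS K × HS K)) : Set (HS K × HS K) :=
  {p | ∀ q ∈ G, inner ℂ p.1 q.2 = conj (inner ℂ p.2 q.1)}

theorem mem_tomitaGraph (ρ σ : DensityOperator K) (X : K →L[ℂ] K) (Y : HS K) :
    (HS.lmul X σ.sqrt + HS.rmul Y (1 - σ.supportProj),
      HS.lmul (σ.supportProj * X.adjoint) ρ.sqrt) ∈ tomitaGraph ρ σ := ⟨X, Y, rfl, rfl⟩

/-- The domain of `S` is dense. -/
theorem eq_zero_of_inner_dom (ρ σ : DensityOperator K) (z : HS K)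
    (hz : ∀ q ∈ tomitaGraph ρ σ, inner ℂ q.1 z = 0) : z = 0 := by
  have h1 : ∀ y, z.op (CFC.sqrt σ.op y) = 0 := by
    intro y
    have h := hz _ (mem_tomitaGraph ρ σ
      (InnerProductSpace.rankOne ℂ (z.op (CFC.sqrt σ.op y)) y) 0)
    have h2 : HS.lmul (InnerProductSpace.rankOne ℂ (z.op (CFC.sqrt σ.op y)) y) σ.sqrt
        + HS.rmul 0 (1 - σ.supportProj)
        = HS.ketBra (z.op (CFC.sqrt σ.op y)) (CFC.sqrt σ.op y) := by
      ext w
      simp [HS.ketBra_apply, σ.inner_sqrt]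
    rw [h2, HS.inner_ketBra] at h
    exact inner_self_eq_zero.1 h
  have h3 : ∀ y, z.op (y - σ.supportProj y) = 0 := by
    intro y
    have h := hz _ (mem_tomitaGraph ρ σ 0 (HS.ketBra (z.op (y - σ.supportProj y)) y))
    have h2 : HS.lmul 0 σ.sqrt
        + HS.rmul (HS.ketBra (z.op (y - σ.supportProj y)) y) (1 - σ.supportProj)
        = HS.ketBra (z.op (y - σ.supportProj y)) (y - σ.supportProj y) := by
      ext w
      simp [HS.ketBra_apply, σ.inner_supportProj]
    rw [h2, HS.inner_ketBra] at h
    exact inner_self_eq_zero.1 h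
  ext x
  have h4 : z.op x = z.op (σ.supportProj x) := by
    have := h3 x
    rwa [map_sub, sub_eq_zero] at this
  have h5 : ∀ w, σ.supportProj (z.op.adjoint w) = 0 := by
    intro w
    rw [σ.supportProj_eq_zero, ← σ.sqrt_apply_eq_zero]
    refine ext_inner_right ℂ fun y => ?_
    rw [σ.inner_sqrt, ContinuousLinearMap.adjoint_inner_left, h1]
    simp
  rw [h4]
  refine ext_inner_left ℂ fun w => ?_
  rw [← ContinuousLinearMap.adjoint_inner_left, ← σ.inner_supportProj, h5]
  simp

/-- The domain of the adjoint of `S` is dense. -/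
theorem eq_zero_of_inner_dom_adjoint (ρ σ : DensityOperator K) (z : HS K)
    (hz : ∀ p ∈ adjointGraph (tomitaGraph ρ σ), inner ℂ p.1 z = 0) : z = 0 := by
  have h1 : ∀ x, CFC.sqrt σ.op (z.op x) = 0 := by
    intro x
    refine ext_inner_left ℂ fun y => ?_
    have h := hz (HS.ketBra (CFC.sqrt σ.op y) x, HS.ketBra (CFC.sqrt ρ.op x) (σ.supportProj y)) (by
      rintro ⟨a, b⟩ ⟨X, Y, rfl, rfl⟩
      simp only [HS.inner_ketBra, inner_conj_symm]
      simp only [HS.op_lmul, mul_apply_eq_comp, DensityOperator.op_sqrt, map_add,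
        HS.op_rmul, add_apply, sub_apply, one_apply_eq_self, σ.supportProj_idem, sub_self,
        map_zero, add_zero, σ.sqrt_supportProj]
      rw [← σ.inner_supportProj, ContinuousLinearMap.adjoint_inner_right,
        σ.supportProj_sqrt])
    rw [HS.inner_ketBra, σ.inner_sqrt] at h
    simpa using h
  have h2 : ∀ x, z.op x = σ.supportProj (z.op x) := by
    intro x
    refine ext_inner_left ℂ fun y => ?_
    have h := hz (HS.ketBra (y - σ.supportProj y) x, 0) (by
      rintro ⟨a, b⟩ ⟨X, Y, rfl, rfl⟩
      simp [HS.inner_ketBra, σ.inner_supportProj, σ.supportProj_idem])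
    rw [HS.inner_ketBra, inner_sub_left, sub_eq_zero, σ.inner_supportProj] at h
    exact h
  ext x
  rw [h2, σ.supportProj_eq_zero.2 (σ.sqrt_apply_eq_zero.1 (h1 x))]
  simp

/-- The adjoint of `S` is single-valued. -/
theorem adjointGraph_single (ρ σ : DensityOperator K) {a b c : HS K}
    (hb : (a, b) ∈ adjointGraph (tomitaGraph ρ σ))
    (hc : (a, c) ∈ adjointGraph (tomitaGraph ρ σ)) : b = c := by
  refine sub_eq_zero.1 (eq_zero_of_inner_dom ρ σ _ fun q hq => ?_)
  have h := (hb q hq).symm.trans (hc q hq)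
  simp only [inner_conj_symm] at h
  rw [inner_sub_right, h, sub_self]

theorem closure_adjointGraph {G : Set (HS K × HS K)} {p q : HS K × HS K}
    (hp : p ∈ adjointGraph G) (hq : q ∈ closure G) :
    inner ℂ p.1 q.2 = conj (inner ℂ p.2 q.1) := by
  have hcl : IsClosed {q : HS K × HS K | inner ℂ p.1 q.2 = conj (inner ℂ p.2 q.1)} :=
    isClosed_eq (by fun_prop) (Complex.continuous_conj.comp (by fun_prop))
  exact closure_minimal (fun q hq => hp q hq) hcl hq

/-- `S` is closable: the closure of its graph is the graph of an operator. -/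
theorem closure_tomitaGraph_single (ρ σ : DensityOperator K) {a b c : HS K}
    (hb : (a, b) ∈ closure (tomitaGraph ρ σ)) (hc : (a, c) ∈ closure (tomitaGraph ρ σ)) :
    b = c := by
  refine sub_eq_zero.1 (eq_zero_of_inner_dom_adjoint ρ σ _ fun p hp => ?_)
  have h := (closure_adjointGraph hp hb).trans (closure_adjointGraph hp hc).symm
  simp only at h
  rw [inner_sub_right, h, sub_self]

/-- `S` is well defined. -/
theorem tomitaGraph_single (ρ σ : DensityOperator K) {a b c : HS K}
    (hb : (a, b) ∈ tomitaGraph ρ σ) (hc : (a, c) ∈ tomitaGraph ρ σ) : b = c :=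
  closure_tomitaGraph_single ρ σ (subset_closure hb) (subset_closure hc)

theorem tomitaGraph_add (ρ σ : DensityOperator K) {p q : HS K × HS K}
    (hp : p ∈ tomitaGraph ρ σ) (hq : q ∈ tomitaGraph ρ σ) : p + q ∈ tomitaGraph ρ σ := by
  obtain ⟨X, Y, h1, h2⟩ := hp
  obtain ⟨X', Y', h1', h2'⟩ := hq
  refine ⟨X + X', Y + Y', ?_, ?_⟩
  · ext w
    simp [h1, h1']
    abel
  · ext w
    simp [h2, h2']

/-- `S` is antilinear. -/
theorem tomitaGraph_smul (ρ σ : DensityOperator K) (c : ℂ) {p : HS K × HS K}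
    (hp : p ∈ tomitaGraph ρ σ) : (c • p.1, conj c • p.2) ∈ tomitaGraph ρ σ := by
  obtain ⟨X, Y, h1, h2⟩ := hp
  refine ⟨c • X, c • Y, ?_, ?_⟩
  · ext w
    simp [h1]
  · ext w
    simp [h2, ContinuousLinearMap.adjoint.map_smulₛₗ]

/-- The graph of `S† S̄`: the pairs `(a, c)` such that `S̄ a = b` and `S† b = c` for some `b`. -/
def modularGraph (ρ σ : DensityOperator K) : Submodule ℂ (HS K × HS K) where
  carrier := {p | ∃ b, (p.1, b) ∈ closure (tomitaGraph ρ σ) ∧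
    (b, p.2) ∈ adjointGraph (tomitaGraph ρ σ)}
  zero_mem' := ⟨0, subset_closure ⟨0, 0, by ext; simp, by ext; simp⟩, fun q _ => by simp⟩
  add_mem' := by
    rintro p q ⟨b, h1, h2⟩ ⟨b', h1', h2'⟩
    refine ⟨b + b', ?_, fun x hx => ?_⟩
    · exact map_mem_closure₂ (f := fun p q : HS K × HS K => p + q) continuous_add h1 h1'
        fun _ h _ h' => tomitaGraph_add ρ σ h h'
    · have e1 := h2 x hx
      have e2 := h2' x hx
      simp only [Prod.snd_add, inner_add_left, map_add] at *
      rw [e1, e2]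
  smul_mem' := by
    rintro c p ⟨b, h1, h2⟩
    refine ⟨conj c • b, ?_, fun x hx => ?_⟩
    · exact map_mem_closure (f := fun p : HS K × HS K => (c • p.1, conj c • p.2))
        (by fun_prop) h1 fun _ h => tomitaGraph_smul ρ σ c h
    · have e1 := h2 x hx
      simp only [Prod.smul_snd, inner_smul_left, map_mul, Complex.conj_conj] at *
      rw [e1]

/-- The relative modular operator `Δ_{ρ,σ} = S† S̄`, an unbounded linear operator. -/
def relativeModular (ρ σ : DensityOperator K) : HS K →ₗ.[ℂ] HS K :=
  (modularGraph ρ σ).toLinearPMap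

theorem graph_relativeModular (ρ σ : DensityOperator K) :
    (relativeModular ρ σ).graph = modularGraph ρ σ := by
  refine Submodule.toLinearPMap_graph_eq _ ?_
  rintro ⟨a, c⟩ ⟨b, h1, h2⟩ ha
  simp only at ha
  subst ha
  have h0 : ((0 : HS K), (0 : HS K)) ∈ tomitaGraph ρ σ :=
    ⟨0, 0, by ext; simp, by ext; simp⟩
  have hb : b = 0 := closure_tomitaGraph_single ρ σ h1 (subset_closure h0)
  subst hb
  exact adjointGraph_single ρ σ h2 fun q _ => by simp

end RelMod

end

/-!
In the orthonormal bases `X i j = |u i⟩⟨v j|` and `X' i j = |v j⟩⟨u i|`, both `S` and `S†` are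
antilinear and diagonal: `S (X i j) = √(r i / s j) • X' i j` and
`S† (X' i j) = √(r i / s j) • X i j`. Pairing with basis vectors therefore determines the graphs of
`S̄` and of `S†` coordinatewise, and their composition is the diagonal operator with entries
`r i / s j`. An intermediate vector exists for every `a` with `(r i / s j) ⟪X i j, a⟫` square
summable because `t ≤ 1 + t²` makes the middle coordinates `√(r i / s j) ⟪X i j, a⟫` square
summable as well.
-/

namespace RelMod

open scoped ComplexConjugate

section HilbertBasis

variable {𝕜 E ι κ : Type*} [RCLike 𝕜] [NormedAddCommGroup E] [InnerProductSpace 𝕜 E]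

theorem hilbertBasis_ext_inner (b : HilbertBasis ι 𝕜 E) {x y : E}
    (h : ∀ i, inner 𝕜 (b i) x = inner 𝕜 (b i) y) : x = y := by
  refine b.repr.injective (lp.ext <| funext fun i => ?_)
  rw [b.repr_apply_apply, b.repr_apply_apply, h]

theorem hilbertBasis_hasSum_inner_smul (b : HilbertBasis ι 𝕜 E) (x : E) :
    HasSum (fun i => inner 𝕜 (b i) x • b i) x := by
  simpa only [b.repr_apply_apply] using b.hasSum_repr x

theorem exists_forall_inner_eq_iff_summable (b : HilbertBasis ι 𝕜 E) {f : ι → 𝕜} :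
    (∃ x, ∀ i, inner 𝕜 (b i) x = f i) ↔ Summable fun i => ‖f i‖ ^ 2 := by
  constructor
  · rintro ⟨x, hx⟩
    simpa only [hx] using b.orthonormal.inner_products_summable x
  · intro hf
    have hmem : Memℓp f 2 := (memℓp_gen_iff (by norm_num)).2 (by simpa using hf)
    exact ⟨b.repr.symm ⟨f, hmem⟩, fun i => by
      rw [← b.repr_apply_apply, LinearIsometryEquiv.apply_symm_apply]⟩

theorem mem_topologicalClosure_span_image_iff (b : HilbertBasis ι 𝕜 E) (t : Set ι) {x : E} :
    x ∈ (Submodule.span 𝕜 (b '' t)).topologicalClosure ↔ ∀ i ∉ t, inner 𝕜 (b i) x = 0 := by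
  constructor
  · intro hx i hi
    have hle : Submodule.span 𝕜 (b '' t) ≤ (innerSL 𝕜 (b i)).ker := by
      rw [Submodule.span_le]
      rintro _ ⟨j, hj, rfl⟩
      exact b.orthonormal.inner_eq_zero fun hij => hi (hij ▸ hj)
    exact Submodule.topologicalClosure_minimal _ hle (innerSL 𝕜 (b i)).isClosed_ker hx
  · intro hx
    refine mem_closure_of_tendsto (hilbertBasis_hasSum_inner_smul b x)
      (.of_forall fun F => Submodule.sum_mem _ fun i _ => ?_)
    by_cases hi : i ∈ t
    · exact Submodule.smul_mem _ _ (Submodule.subset_span ⟨i, hi, rfl⟩)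
    · rw [hx i hi, zero_smul]
      exact Submodule.zero_mem _

/-- The Hilbert basis `b` with its index set transported along `e`. -/
noncomputable def reindexHilbertBasis [CompleteSpace E] (b : HilbertBasis ι 𝕜 E) (e : ι ≃ κ) :
    HilbertBasis κ 𝕜 E :=
  HilbertBasis.mk (b.orthonormal.comp e.symm e.symm.injective) (by
    rw [e.symm.surjective.range_comp, b.dense_span])

@[simp] theorem reindexHilbertBasis_apply [CompleteSpace E] (b : HilbertBasis ι 𝕜 E) (e : ι ≃ κ)
    (k : κ) : reindexHilbertBasis b e k = b (e.symm k) := by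
  simp [reindexHilbertBasis]

theorem apply_eq_smul_of_hasSum_rankOne {v : ι → E} (hv : Orthonormal 𝕜 v) {c : ι → 𝕜}
    {T : E →L[𝕜] E} (hT : HasSum (fun j => c j • InnerProductSpace.rankOne 𝕜 (v j) (v j)) T)
    (j : ι) : T (v j) = c j • v j := by
  have hTv := hT.mapL (ContinuousLinearMap.apply 𝕜 E (v j))
  have hsingle : HasSum (fun k => c k • inner 𝕜 (v k) (v j) • v k)
      (c j • inner 𝕜 (v j) (v j) • v j) :=
    hasSum_single j fun k hk => by rw [hv.inner_eq_zero hk, zero_smul, smul_zero]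
  refine (hTv.unique hsingle).trans ?_
  rw [inner_self_eq_norm_sq_to_K, hv.norm_eq_one]
  simp

end HilbertBasis

section DiagonalOperator

variable {𝕜 E ι : Type*} [RCLike 𝕜] [NormedAddCommGroup E] [InnerProductSpace 𝕜 E]

/-- `T` is the maximal diagonal operator `∑ i, d i |b i⟩⟨b i|` in the Hilbert basis `b`: its graph,
and hence its domain, is as large as the entries `d` allow. -/
def IsDiagonalPMap (T : E →ₗ.[𝕜] E) (b : HilbertBasis ι 𝕜 E) (d : ι → 𝕜) : Prop :=
  ∀ x y, (x, y) ∈ T.graph ↔ ∀ i, inner 𝕜 (b i) y = d i * inner 𝕜 (b i) x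

namespace IsDiagonalPMap

variable {T : E →ₗ.[𝕜] E} {b : HilbertBasis ι 𝕜 E} {d : ι → 𝕜}

theorem mem_domain_iff_summable (hT : IsDiagonalPMap T b d) {t : Set ι}
    (ht : Function.support d ⊆ t) (x : E) :
    x ∈ T.domain ↔ Summable fun i : t => ‖d i‖ ^ 2 * ‖inner 𝕜 (b i) x‖ ^ 2 := by
  rw [LinearPMap.mem_domain_iff, exists_congr (hT x), exists_forall_inner_eq_iff_summable,
    ← Function.Injective.summable_iff (Subtype.val_injective (p := (· ∈ t))) fun i hi => ?_]
  · simp only [Function.comp_def, norm_mul, mul_pow]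
  · rw [Function.support_subset_iff'.1 ht i (by simpa using hi), zero_mul, norm_zero,
      zero_pow two_ne_zero]

theorem hasSum_apply (hT : IsDiagonalPMap T b d) {t : Set ι} (ht : Function.support d ⊆ t)
    (x : T.domain) : HasSum (fun i : t => d i • inner 𝕜 (b i) (x : E) • b i) (T x) := by
  have hcoord := (hT x (T x)).1 (T.mem_graph x)
  have hsum := hilbertBasis_hasSum_inner_smul b (T x)
  simp only [hcoord, mul_smul] at hsum
  refine (Function.Injective.hasSum_iff Subtype.val_injective fun i hi => ?_).2 hsum
  rw [Function.support_subset_iff'.1 ht i (by simpa using hi), zero_smul]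

theorem exists_apply_basis (hT : IsDiagonalPMap T b d) (i : ι) :
    ∃ h : b i ∈ T.domain, T ⟨b i, h⟩ = d i • b i := by
  have hgraph : (b i, d i • b i) ∈ T.graph := (hT _ _).2 fun j => by
    rw [inner_smul_right]
    rcases eq_or_ne j i with rfl | hji
    · rfl
    · rw [b.orthonormal.inner_eq_zero hji, mul_zero, mul_zero]
  have hmem := LinearPMap.mem_domain_of_mem_graph hgraph
  exact ⟨hmem, ((LinearPMap.image_iff hmem).2 hgraph).symm⟩

theorem map_ker_eq_topologicalClosure_span (hT : IsDiagonalPMap T b d) :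
    (LinearMap.ker T.toFun).map T.domain.subtype =
      (Submodule.span 𝕜 (b '' {i | d i = 0})).topologicalClosure := by
  ext x
  have hker : x ∈ (LinearMap.ker T.toFun).map T.domain.subtype ↔ (x, 0) ∈ T.graph := by
    rw [LinearPMap.mem_graph_iff, Submodule.mem_map]
    exact exists_congr fun _ => and_comm
  rw [hker, hT, mem_topologicalClosure_span_image_iff]
  refine forall_congr' fun i => ?_
  rw [inner_zero_right, zero_eq_mul, Set.mem_ofPred_eq, or_iff_not_imp_left]

end IsDiagonalPMap

end DiagonalOperator

section ConjDiagonal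

variable {𝕜 E F ι : Type*} [RCLike 𝕜] [NormedAddCommGroup E] [InnerProductSpace 𝕜 E]
  [NormedAddCommGroup F] [InnerProductSpace 𝕜 F]

/-- The graph of the maximal antilinear operator sending `b i` to `d i • b' i`. -/
def conjDiagonalGraph (b : HilbertBasis ι 𝕜 E) (b' : HilbertBasis ι 𝕜 F) (d : ι → 𝕜) :
    Set (E × F) :=
  {p | ∀ i, inner 𝕜 (b' i) p.2 = d i * conj (inner 𝕜 (b i) p.1)}

variable {b : HilbertBasis ι 𝕜 E} {b' : HilbertBasis ι 𝕜 F} {d : ι → 𝕜}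

theorem isClosed_conjDiagonalGraph (b : HilbertBasis ι 𝕜 E) (b' : HilbertBasis ι 𝕜 F)
    (d : ι → 𝕜) : IsClosed (conjDiagonalGraph b b' d) := by
  simp only [conjDiagonalGraph, Set.ofPred_forall]
  exact isClosed_iInter fun i => isClosed_eq (by fun_prop)
    (continuous_const.mul (RCLike.continuous_conj.comp (by fun_prop)))

theorem closure_eq_conjDiagonalGraph {G : Set (E × F)} (hzero : 0 ∈ G)
    (hadd : ∀ p ∈ G, ∀ q ∈ G, p + q ∈ G)
    (hsmul : ∀ c : 𝕜, ∀ p ∈ G, (c • p.1, conj c • p.2) ∈ G)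
    (hbasis : ∀ i, (b i, d i • b' i) ∈ G) (hsub : G ⊆ conjDiagonalGraph b b' d) :
    closure G = conjDiagonalGraph b b' d := by
  refine (closure_minimal hsub (isClosed_conjDiagonalGraph b b' d)).antisymm ?_
  rintro ⟨x, y⟩ hxy
  have hexpand := (hilbertBasis_hasSum_inner_smul b x).prodMk (hilbertBasis_hasSum_inner_smul b' y)
  refine mem_closure_of_tendsto hexpand (.of_forall fun t => ?_)
  refine Finset.sum_induction _ (· ∈ G) (fun p q hp hq => hadd p hp q hq) hzero fun i _ => ?_
  rw [hxy i, mul_comm, mul_smul]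
  exact hsmul _ _ (hbasis i)

theorem forall_inner_eq_conj_inner_iff_mem_conjDiagonalGraph {G : Set (E × F)}
    (hbasis : ∀ i, (b i, d i • b' i) ∈ G) (hsub : G ⊆ conjDiagonalGraph b b' d) (y : F) (z : E) :
    (∀ q ∈ G, inner 𝕜 y q.2 = conj (inner 𝕜 z q.1)) ↔ (y, z) ∈ conjDiagonalGraph b' b d := by
  constructor
  · intro h i
    have hi := h _ (hbasis i)
    rwa [inner_smul_right, inner_conj_symm, ← inner_conj_symm y, eq_comm] at hi
  · intro hyz q hq
    rw [inner_conj_symm]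
    refine (b'.hasSum_inner_mul_inner y q.2).unique
      ((b.hasSum_inner_mul_inner q.1 z).congr_fun fun i => ?_)
    rw [hsub hq i, hyz i, ← inner_conj_symm y, ← inner_conj_symm q.1]
    ring

theorem exists_mem_conjDiagonalGraph_comp_iff (x z : E) :
    (∃ y, (x, y) ∈ conjDiagonalGraph b b' d ∧ (y, z) ∈ conjDiagonalGraph b' b d) ↔
      ∀ i, inner 𝕜 (b i) z = ((‖d i‖ ^ 2 : ℝ) : 𝕜) * inner 𝕜 (b i) x := by
  have hcomp (i : ι) : d i * conj (d i * conj (inner 𝕜 (b i) x)) =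
      ((‖d i‖ ^ 2 : ℝ) : 𝕜) * inner 𝕜 (b i) x := by
    rw [map_mul, RCLike.conj_conj, ← mul_assoc, RCLike.mul_conj, RCLike.ofReal_pow]
  constructor
  · rintro ⟨y, hxy, hyz⟩ i
    rw [hyz i, hxy i, hcomp]
  · intro h
    have hsummable : Summable fun i => ‖d i * conj (inner 𝕜 (b i) x)‖ ^ 2 := by
      refine .of_nonneg_of_le (fun i => by positivity) (fun i => ?_)
        ((b.orthonormal.inner_products_summable x).add (b.orthonormal.inner_products_summable z))
      rw [h i, norm_mul, norm_mul, RCLike.norm_conj, RCLike.norm_ofReal,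
        abs_of_nonneg (sq_nonneg _)]
      nlinarith [mul_nonneg (sq_nonneg ‖inner 𝕜 (b i) x‖) (sq_nonneg (‖d i‖ ^ 2 - 1)),
        mul_nonneg (sq_nonneg ‖inner 𝕜 (b i) x‖) (sq_nonneg ‖d i‖)]
    obtain ⟨y, hy⟩ := (exists_forall_inner_eq_iff_summable b').2 hsummable
    exact ⟨y, hy, fun i => by rw [hy i, hcomp, h i]⟩

end ConjDiagonal

section EigenvectorsOfPositive

variable {𝕜 E : Type*} [RCLike 𝕜] [NormedAddCommGroup E] [InnerProductSpace 𝕜 E]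

theorem apply_eq_smul_of_apply_apply_eq_sq_smul {B : E →L[𝕜] E} (hB : B.IsPositive)
    {c : ℝ} (hc : 0 ≤ c) {x : E} (hx : B (B x) = ((c ^ 2 : ℝ) : 𝕜) • x) :
    B x = (c : 𝕜) • x := by
  set w := B x - (c : 𝕜) • x with hw
  have hBw : B w = ((-c : ℝ) : 𝕜) • w := by
    rw [hw, map_sub, map_smul, hx, smul_sub, smul_smul]
    push_cast
    module
  rw [← sub_eq_zero, ← hw]
  rcases hc.eq_or_lt with rfl | hc
  · have hBx : inner 𝕜 (B x) (B x) = 0 := by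
      rw [hB.inner_left_eq_inner_right, hx]
      simp
    simpa [hw] using hBx
  · by_contra hne
    have heigen : Module.End.HasEigenvalue (B : E →ₗ[𝕜] E) ((-c : ℝ) : 𝕜) :=
      Module.End.hasEigenvalue_of_hasEigenvector ⟨Module.End.mem_eigenspace_iff.2 hBw, hne⟩
    have := eigenvalue_nonneg_of_nonneg heigen fun y => hB.re_inner_nonneg_right y
    linarith

end EigenvectorsOfPositive

variable {K : Type*} [NormedAddCommGroup K] [InnerProductSpace ℂ K] [CompleteSpace K]
  {ι κ : Type*}

namespace HS

theorem ketBra_smul_right (c : ℂ) (x y : K) : ketBra x (c • y) = conj c • ketBra x y := by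
  ext w
  simp only [map_smul, smul_apply, ketBra_apply, inner_smul_left, mul_smul]

end HS

namespace DensityOperator

theorem sqrt_apply_of_apply_eq_smul (σ : DensityOperator K) {x : K} {c : ℝ} (hc : 0 ≤ c)
    (hx : σ.op x = (c : ℂ) • x) : CFC.sqrt σ.op x = ((√c : ℝ) : ℂ) • x := by
  refine apply_eq_smul_of_apply_apply_eq_sq_smul σ.sqrt_isPositive c.sqrt_nonneg ?_
  rw [← mul_apply_eq_comp, sqrt_mul_sqrt, hx, Real.sq_sqrt hc]
  rfl

theorem supportProj_apply_of_apply_eq_smul (σ : DensityOperator K) {x : K} {c : ℝ} (hc : c ≠ 0)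
    (hx : σ.op x = (c : ℂ) • x) : σ.supportProj x = x := by
  refine Submodule.starProjection_eq_self_iff.2 fun y (hy : σ.op y = 0) => ?_
  have h : (c : ℂ) * inner ℂ y x = 0 := by
    rw [← inner_smul_right, ← hx, ← σ.isPositive.inner_left_eq_inner_right, hy, inner_zero_left]
  exact (mul_eq_zero.1 h).resolve_left (Complex.ofReal_ne_zero.2 hc)

end DensityOperator

/-- The Hilbert basis `|u i⟩⟨v j|` of `HS K`. -/
noncomputable def ketBraBasis (u : HilbertBasis ι ℂ K) (v : HilbertBasis κ ℂ K) :
    HilbertBasis (ι × κ) ℂ (HS K) :=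
  HilbertBasis.mkOfOrthogonalEqBot (v := fun p : ι × κ => HS.ketBra (u p.1) (v p.2))
    (by
      classical
      rw [orthonormal_iff_ite]
      rintro ⟨i, j⟩ ⟨k, l⟩
      rw [HS.inner_ketBra, HS.ketBra_apply, inner_smul_right,
        orthonormal_iff_ite.1 u.orthonormal, orthonormal_iff_ite.1 v.orthonormal]
      by_cases hik : i = k <;> by_cases hjl : j = l <;> simp [hik, hjl, eq_comm])
    (by
      rw [Submodule.eq_bot_iff]
      intro A hA
      ext1
      refine ContinuousLinearMap.ext_on
        (Submodule.dense_iff_topologicalClosure_eq_top.2 v.dense_span) ?_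
      rintro _ ⟨j, rfl⟩
      refine hilbertBasis_ext_inner u fun i => ?_
      rw [← HS.inner_ketBra, hA _ (Submodule.subset_span ⟨(i, j), rfl⟩)]
      simp)

@[simp] theorem ketBraBasis_apply (u : HilbertBasis ι ℂ K) (v : HilbertBasis κ ℂ K)
    (p : ι × κ) : ketBraBasis u v p = HS.ketBra (u p.1) (v p.2) := by
  simp [ketBraBasis]

section Tomita

variable {ρ σ : DensityOperator K}

theorem ketBra_sqrt_mem_tomitaGraph (ρ σ : DensityOperator K) (x y : K) :
    (HS.ketBra x (CFC.sqrt σ.op y), HS.ketBra (σ.supportProj y) (CFC.sqrt ρ.op x)) ∈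
      tomitaGraph ρ σ := by
  refine ⟨InnerProductSpace.rankOne ℂ x y, 0, ?_, ?_⟩
  · ext w
    simp [HS.ketBra_apply, DensityOperator.inner_sqrt]
  · ext w
    simp [HS.ketBra_apply, DensityOperator.inner_sqrt]

theorem ketBra_sub_supportProj_mem_tomitaGraph (ρ σ : DensityOperator K) (x y : K) :
    (HS.ketBra x (y - σ.supportProj y), 0) ∈ tomitaGraph ρ σ := by
  refine ⟨0, HS.ketBra x y, ?_, ?_⟩
  · ext w
    simp [HS.ketBra_apply, σ.inner_supportProj]
  · ext w
    simp

/-- For `c = 0` the pair is `(|x⟩⟨y|, 0)`, since `a / 0 = 0`. -/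
theorem ketBra_mem_tomitaGraph {a c : ℝ} (ha : 0 ≤ a) (hc : 0 ≤ c) {x y : K}
    (hx : ρ.op x = (a : ℂ) • x) (hy : σ.op y = (c : ℂ) • y) :
    (HS.ketBra x y, ((√(a / c) : ℝ) : ℂ) • HS.ketBra y x) ∈ tomitaGraph ρ σ := by
  rcases hc.eq_or_lt with rfl | hc
  · have hproj : σ.supportProj y = 0 := σ.supportProj_eq_zero.2 (by simp [hy])
    simpa [hproj] using ketBra_sub_supportProj_mem_tomitaGraph ρ σ x y
  · have hsqrt : ((√c : ℝ) : ℂ) ≠ 0 := Complex.ofReal_ne_zero.2 (Real.sqrt_pos.2 hc).ne'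
    have hmem := tomitaGraph_smul ρ σ (((√c : ℝ) : ℂ)⁻¹) (ketBra_sqrt_mem_tomitaGraph ρ σ x y)
    rw [ρ.sqrt_apply_of_apply_eq_smul ha hx, σ.sqrt_apply_of_apply_eq_smul hc.le hy,
      σ.supportProj_apply_of_apply_eq_smul hc.ne' hy] at hmem
    simp only [HS.ketBra_smul_right, smul_smul, map_inv₀, Complex.conj_ofReal,
      inv_mul_cancel₀ hsqrt, one_smul] at hmem
    rwa [Real.sqrt_div ha, Complex.ofReal_div, div_eq_inv_mul]

theorem ketBra_mem_adjointGraph_tomitaGraph {a c : ℝ} (ha : 0 ≤ a) (hc : 0 ≤ c) {x y : K}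
    (hx : ρ.op x = (a : ℂ) • x) (hy : σ.op y = (c : ℂ) • y) :
    (HS.ketBra y x, ((√(a / c) : ℝ) : ℂ) • HS.ketBra x y) ∈ adjointGraph (tomitaGraph ρ σ) := by
  rintro q ⟨X, Y, hdom, hrange⟩
  rw [hdom, hrange, inner_smul_left, HS.inner_ketBra, HS.inner_ketBra]
  simp only [map_add, HS.op_lmul, HS.op_rmul, add_apply, mul_apply_eq_comp,
    DensityOperator.op_sqrt, ρ.sqrt_apply_of_apply_eq_smul ha hx,
    σ.sqrt_apply_of_apply_eq_smul hc hy, sub_apply, one_apply_eq_self]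
  rw [← σ.inner_supportProj]
  rcases hc.eq_or_lt with rfl | hc
  · have hproj : σ.supportProj y = 0 := σ.supportProj_eq_zero.2 (by simp [hy])
    simp [hproj]
  · have hsqrt : ((√c : ℝ) : ℂ) ≠ 0 := Complex.ofReal_ne_zero.2 (Real.sqrt_pos.2 hc).ne'
    rw [σ.supportProj_apply_of_apply_eq_smul hc.ne' hy, sub_self, map_zero, add_zero, map_smul,
      map_smul, inner_smul_right, inner_smul_right, ContinuousLinearMap.adjoint_inner_right,
      map_mul, map_mul, inner_conj_symm, Complex.conj_conj, Complex.conj_ofReal,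
      Real.sqrt_div ha, Complex.ofReal_div]
    field_simp

variable {u : HilbertBasis ι ℂ K} {v : HilbertBasis κ ℂ K} {r : ι → ℝ} {s : κ → ℝ}

theorem isDiagonalPMap_relativeModular
    (hr : ∀ i, 0 ≤ r i) (hρ : ∀ i, ρ.op (u i) = (r i : ℂ) • u i)
    (hs : ∀ j, 0 ≤ s j) (hσ : ∀ j, σ.op (v j) = (s j : ℂ) • v j) :
    IsDiagonalPMap (relativeModular ρ σ) (ketBraBasis u v)
      fun p => ((r p.1 / s p.2 : ℝ) : ℂ) := by
  let b := ketBraBasis u v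
  let b' := reindexHilbertBasis (ketBraBasis v u) (Equiv.prodComm κ ι)
  let d : ι × κ → ℂ := fun p => (√(r p.1 / s p.2) : ℝ)
  have hbasis (p : ι × κ) : (b p, d p • b' p) ∈ tomitaGraph ρ σ := by
    simpa [b, b', d] using ketBra_mem_tomitaGraph (hr p.1) (hs p.2) (hρ p.1) (hσ p.2)
  have hsub : tomitaGraph ρ σ ⊆ conjDiagonalGraph b b' d := by
    intro q hq p
    have h := ketBra_mem_adjointGraph_tomitaGraph (hr p.1) (hs p.2) (hρ p.1) (hσ p.2) q hq
    rw [inner_smul_left, map_mul, Complex.conj_conj] at h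
    simpa only [b, b', d, reindexHilbertBasis_apply, ketBraBasis_apply, Equiv.prodComm_symm,
      Equiv.prodComm_apply, Prod.fst_swap, Prod.snd_swap] using h
  have hclosure : closure (tomitaGraph ρ σ) = conjDiagonalGraph b b' d :=
    closure_eq_conjDiagonalGraph ⟨0, 0, by ext; simp, by ext; simp⟩
      (fun _ hp _ hq => tomitaGraph_add ρ σ hp hq) (fun c _ hp => tomitaGraph_smul ρ σ c hp)
      hbasis hsub
  have hadjoint : adjointGraph (tomitaGraph ρ σ) = conjDiagonalGraph b' b d := by
    ext ⟨y, z⟩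
    exact forall_inner_eq_conj_inner_iff_mem_conjDiagonalGraph hbasis hsub y z
  have hnorm (p : ι × κ) : ‖d p‖ ^ 2 = r p.1 / s p.2 := by
    rw [Complex.norm_real, Real.norm_eq_abs, sq_abs, Real.sq_sqrt (div_nonneg (hr _) (hs _))]
  intro x z
  have hgraph : (x, z) ∈ (relativeModular ρ σ).graph ↔
      ∃ y, (x, y) ∈ closure (tomitaGraph ρ σ) ∧ (y, z) ∈ adjointGraph (tomitaGraph ρ σ) := by
    rw [graph_relativeModular]
    rfl
  rw [hgraph, hclosure, hadjoint, exists_mem_conjDiagonalGraph_comp_iff]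
  simp_rw [hnorm]
  rfl

end Tomita

end RelMod

theorem propositionB1 {K : Type*} [NormedAddCommGroup K] [InnerProductSpace ℂ K] [CompleteSpace K]
    {ι : Type*} (ρ σ : RelMod.DensityOperator K) (u v : HilbertBasis ι ℂ K) (r s : ι → ℝ)
    (hr : ∀ i, 0 ≤ r i) (hr_sum : HasSum r 1)
    (hρ : HasSum (fun i => (r i : ℂ) • InnerProductSpace.rankOne ℂ (u i) (u i)) ρ.op)
    (hs : ∀ j, 0 ≤ s j) (hs_sum : HasSum s 1)
    (hσ : HasSum (fun j => (s j : ℂ) • InnerProductSpace.rankOne ℂ (v j) (v j)) σ.op) :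
    -- the `X i j = |u i⟩⟨v j|` form an orthonormal basis of the Hilbert–Schmidt operators
    (∃ b : HilbertBasis (ι × ι) ℂ (RelMod.HS K),
      ∀ i j, b (i, j) = RelMod.HS.ketBra (u i) (v j)) ∧
    -- the domain and the action of `Δ = ∑ (r i / s j) |X i j⟩⟨X i j|`
    (∀ A : RelMod.HS K, A ∈ (RelMod.relativeModular ρ σ).domain ↔
      Summable fun p : {p : ι × ι // r p.1 ≠ 0 ∧ s p.2 ≠ 0} =>
        (r p.1.1 / s p.1.2) ^ 2 *
          ‖inner ℂ (RelMod.HS.ketBra (u p.1.1) (v p.1.2)) A‖ ^ 2) ∧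
    (∀ A : (RelMod.relativeModular ρ σ).domain,
      HasSum (fun p : {p : ι × ι // r p.1 ≠ 0 ∧ s p.2 ≠ 0} =>
        ((r p.1.1 / s p.1.2 : ℝ) : ℂ) •
          inner ℂ (RelMod.HS.ketBra (u p.1.1) (v p.1.2)) (A : RelMod.HS K) •
            RelMod.HS.ketBra (u p.1.1) (v p.1.2))
        (RelMod.relativeModular ρ σ A)) ∧
    -- eigenvectors for the nonzero eigenvalues
    (∀ i j, r i ≠ 0 → s j ≠ 0 →
      ∃ h : RelMod.HS.ketBra (u i) (v j) ∈ (RelMod.relativeModular ρ σ).domain,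
        RelMod.relativeModular ρ σ ⟨RelMod.HS.ketBra (u i) (v j), h⟩ =
          ((r i / s j : ℝ) : ℂ) • RelMod.HS.ketBra (u i) (v j)) ∧
    -- the kernel
    (LinearMap.ker (RelMod.relativeModular ρ σ).toFun).map
        (RelMod.relativeModular ρ σ).domain.subtype =
      (Submodule.span ℂ {A : RelMod.HS K | ∃ i j, (r i = 0 ∨ s j = 0) ∧
        A = RelMod.HS.ketBra (u i) (v j)}).topologicalClosure := by
  have hΔ := RelMod.isDiagonalPMap_relativeModular (ρ := ρ) (σ := σ) hr
    (RelMod.apply_eq_smul_of_hasSum_rankOne u.orthonormal hρ) hs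
    (RelMod.apply_eq_smul_of_hasSum_rankOne v.orthonormal hσ)
  have hsupp : Function.support (fun p : ι × ι => ((r p.1 / s p.2 : ℝ) : ℂ)) ⊆
      {p | r p.1 ≠ 0 ∧ s p.2 ≠ 0} := fun p hp => by
    simpa [Function.mem_support] using hp
  have hzero : RelMod.ketBraBasis u v '' {p | ((r p.1 / s p.2 : ℝ) : ℂ) = 0} =
      {A | ∃ i j, (r i = 0 ∨ s j = 0) ∧ A = RelMod.HS.ketBra (u i) (v j)} := by
    ext A
    simp [eq_comm]
  refine ⟨⟨RelMod.ketBraBasis u v, by simp⟩, fun A => ?_, fun A => ?_, fun i j _ _ => ?_, ?_⟩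
  · have hdom := hΔ.mem_domain_iff_summable hsupp A
    simp only [RelMod.ketBraBasis_apply, Complex.norm_real, Real.norm_eq_abs, sq_abs] at hdom
    exact hdom
  · have hsum := hΔ.hasSum_apply hsupp A
    simp only [RelMod.ketBraBasis_apply] at hsum
    exact hsum
  · simpa only [RelMod.ketBraBasis_apply] using hΔ.exists_apply_basis (i, j)
  · rw [hΔ.map_ker_eq_topologicalClosure_span, hzero]
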